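/- Let $\omega\in\mathbb R\setminus\mathbb Q$ and $\lambda=e^{2\pi i\omega}$, let $(p_k/q_k)_{k\ge 0}$ be the convergents of the continued fraction of $\omega$ (so $q_0=1$), and for $n\ge 1$ let $k(n)$ be the index with $q_{k(n)}\le n<q_{k(n)+1}$. Call $\omega$ a Brjuno number if $\sum_{k\ge 0}\frac{\log q_{k+1}}{q_k}<+\infty$. Consider sequences $(M_n)_{n\ge1}$ of positive real numbers satisfying the following conditions: 0. $\inf_{n\ge1}M_n^{1/n}>0$; 1. there is $C_1>0$ such that $M_{n+1}\le C_1^{\,n+1}M_n$ for all $n\ge1$; 2. $(M_n)_{n\ge 1}$ is logarithmically convex, i.e. $(M_{n+1}/M_n)_{n\ge1}$ is (weakly) increasing; 3. $M_nM_m\le M_{m+n-1}$ for all $m,n\ge1$. Let $z\mathbb C[[z]]_{(M_n)}$ be the set of formal power series $f=\sum_{n\ge1}f_nz^n\in z\mathbb C[[z]]$ for which there are $c_1,c_2>0$ with $|f_n|\le c_1c_2^nM_n$ for all $n\ge1$, and let $z\mathbb C\{z\}$ be the set of $f\in z\mathbb C[[z]]$ with positive radius of convergence. **Theorem.** Let $(M_n)$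 satisfy 0–3 and let $F(z)=\sum_{n\ge1}f_nz^n\in z\mathbb C[[z]]$ with $f_1=\lambda$. Then there is a unique formal power series $H(z)=z+\sum_{n\ge2}h_nz^n$ with $F(H(z))=H(\lambda z)$ (the linearization of $F$), and: 1. If $F\in z\mathbb C[[z]]_{(M_n)}$ and $\omega$ is a Brjuno number, then $H\in z\mathbb C[[z]]_{(M_n)}$. 2. If $F\in z\mathbb C\{z\}$ and $$\limsup_{n\to+\infty}\left(\sum_{k=0}^{k(n)}\frac{\log q_{k+1}}{q_k}-\frac1n\log M_n\right)<+\infty,$$ then $H\in z\mathbb C[[z]]_{(M_n)}$. 3. If $F\in z\mathbb C[[z]]_{(N_n)}$, where $(N_n)_{n\ge 1}$ is a sequence of positive real numbers which satisfies 0–3 and $N_n\le M_n$ for all sufficiently large $n$, and if $$\limsup_{n\to+\infty}\left(\sum_{k=0}^{k(n)}\frac{\log q_{k+1}}{q_k}-\frac1n\log\frac{M_n}{N_n}\right)<+\infty,$$ then $H\in z\mathbb C[[z]]_{(M_n)}$. -/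

import Mathlib

open Filter
open scoped PowerSeries

noncomputable section

namespace SiegelCenter

/-- The conditions 0, 1, 2, 3 on a sequence `(M_n)_{n ≥ 1}` of positive real numbers.
The value `M 0` plays no role. -/
structure IsUltradifferentiableWeight (M : ℕ → ℝ) : Prop where
  pos : ∀ n : ℕ, 1 ≤ n → 0 < M n
  /-- `inf_{n ≥ 1} M_n ^ (1/n) > 0` -/
  inf_root_pos : 0 < ⨅ n : ℕ+, M n ^ (1 / (n : ℝ))
  derivation : ∃ C₁ : ℝ, 0 < C₁ ∧ ∀ n : ℕ, 1 ≤ n → M (n + 1) ≤ C₁ ^ (n + 1) * M n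
  /-- logarithmic convexity: `M_{n+1} / M_n` is (weakly) increasing -/
  log_convex : ∀ n : ℕ, 1 ≤ n → M (n + 1) / M n ≤ M (n + 2) / M (n + 1)
  composition : ∀ m n : ℕ, 1 ≤ m → 1 ≤ n → M n * M m ≤ M (m + n - 1)

/-- The algebra `z ℂ[[z]]_{(M_n)}`: formal power series without constant term such that
`|f_n| ≤ c₁ c₂ ^ n M_n` for all `n ≥ 1`. -/
def ultradifferentiableClass (M : ℕ → ℝ) : Set ℂ⟦X⟧ :=
  {f | PowerSeries.constantCoeff f = 0 ∧
    ∃ c₁ c₂ : ℝ, 0 < c₁ ∧ 0 < c₂ ∧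
      ∀ n : ℕ, 1 ≤ n → ‖PowerSeries.coeff n f‖ ≤ c₁ * c₂ ^ n * M n}

/-- `z ℂ{z}`: power series without constant term and with positive radius of convergence. -/
def analyticGerms : Set ℂ⟦X⟧ :=
  {f | PowerSeries.constantCoeff f = 0 ∧
    0 < (FormalMultilinearSeries.ofScalars ℂ (fun n : ℕ => PowerSeries.coeff n f)).radius}

/-- `H ∈ z ℂ[[z]]` is tangent to the identity and satisfies `F ∘ H = H ∘ R_lam`,
where `R_lam (z) = lam z`. -/
structure IsLinearization (F : ℂ⟦X⟧) (lam : ℂ) (H : ℂ⟦X⟧) : Prop where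
  constantCoeff_eq : PowerSeries.constantCoeff H = 0
  tangent : PowerSeries.coeff 1 H = 1
  conj : PowerSeries.subst H F = PowerSeries.subst (PowerSeries.C lam * PowerSeries.X : ℂ⟦X⟧) H

/-- The denominator `q_k` of the `k`-th convergent of (the continued fraction of) `ω`;
`q_0 = 1`, `q_1 = a_1`, `q_{k+2} = a_{k+2} q_{k+1} + q_k`. -/
def q (ω : ℝ) (k : ℕ) : ℝ := (GenContFract.of ω).dens k

/-- The Brjuno condition: `B(ω) = ∑_{k ≥ 0} log q_{k+1} / q_k < ∞`. -/
def IsBrjuno (ω : ℝ) : Prop :=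
  Irrational ω ∧ Summable fun k : ℕ => Real.log (q ω (k + 1)) / q ω k

/-- The index `k(n)`: the largest `k` with `q_k ≤ n`.  For `ω` irrational and `n ≥ 1` it is
the unique `k` with `q_k ≤ n < q_{k+1}`, see `kIndex_spec` and `kIndex_unique`. -/
def kIndex (ω : ℝ) (n : ℕ) : ℕ := sSup {k : ℕ | q ω k ≤ n}

/-- The partial Brjuno sum `∑_{k=0}^{k(n)} log q_{k+1} / q_k`. -/
def brjunoSum (ω : ℝ) (n : ℕ) : ℝ :=
  ∑ k ∈ Finset.range (kIndex ω n + 1), Real.log (q ω (k + 1)) / q ω k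

theorem q_zero (ω : ℝ) : q ω 0 = 1 := GenContFract.zeroth_den_eq_one

theorem q_mono (ω : ℝ) : Monotone (q ω) :=
  monotone_nat_of_le_succ fun _ => GenContFract.of_den_mono

theorem not_terminatedAt {ω : ℝ} (hω : Irrational ω) (n : ℕ) :
    ¬ (GenContFract.of ω).TerminatedAt n := by
  intro h
  have : (GenContFract.of ω).Terminates := ⟨n, h⟩
  rw [GenContFract.terminates_iff_rat] at this
  obtain ⟨r, hr⟩ := this
  exact hω ⟨r, hr.symm⟩

theorem fib_le_q {ω : ℝ} (hω : Irrational ω) (n : ℕ) : (Nat.fib (n + 1) : ℝ) ≤ q ω n :=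
  GenContFract.succ_nth_fib_le_of_nth_den (Or.inr (not_terminatedAt hω _))

theorem kIndex_bdd {ω : ℝ} (hω : Irrational ω) (n : ℕ) : BddAbove {k : ℕ | q ω k ≤ n} := by
  refine ⟨n + 1, fun k hk => ?_⟩
  have h1 : (Nat.fib (k + 1) : ℝ) ≤ n := (fib_le_q hω k).trans hk
  have h2 : Nat.fib (k + 1) ≤ n := by exact_mod_cast h1
  have h3 := Nat.le_fib_add_one (k + 1)
  omega

/-- For `n ≥ 1` one has `q_{k(n)} ≤ n < q_{k(n)+1}`. -/
theorem kIndex_spec {ω : ℝ} (hω : Irrational ω) {n : ℕ} (hn : 1 ≤ n) :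
    q ω (kIndex ω n) ≤ n ∧ n < q ω (kIndex ω n + 1) := by
  have hne : {k : ℕ | q ω k ≤ n}.Nonempty :=
    ⟨0, by simpa [q_zero] using (by exact_mod_cast hn : (1 : ℝ) ≤ n)⟩
  refine ⟨Nat.sSup_mem hne (kIndex_bdd hω n), ?_⟩
  by_contra! h
  have := le_csSup (kIndex_bdd hω n) (show kIndex ω n + 1 ∈ {k : ℕ | q ω k ≤ n} from h)
  unfold kIndex at this
  omega

theorem kIndex_unique {ω : ℝ} (hω : Irrational ω) {n k : ℕ} (hn : 1 ≤ n)
    (h : q ω k ≤ n ∧ n < q ω (k + 1)) : k = kIndex ω n := by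
  have hs := kIndex_spec hω hn
  rcases lt_trichotomy k (kIndex ω n) with h1 | h1 | h1
  · exact absurd (q_mono ω (Nat.succ_le_of_lt h1)) (by
      have := h.2.trans_le' hs.1
      simpa using this)
  · exact h1
  · exact absurd (q_mono ω (Nat.succ_le_of_lt h1)) (by
      have := hs.2.trans_le' h.1
      simpa using this)

end SiegelCenter

end

/-!
Comparing coefficients in `F ∘ H = H ∘ R_λ` gives the recursion
`(λ ^ n - λ) h_n = ∑_{2 ≤ m ≤ n} f_m [z ^ n] H ^ m`, which determines `H`. To estimate `h_n` one
looks for a function `K` which is superadditive and satisfies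
`-log |λ ^ n - 1| ≤ K n - K (n - 1)`. Since a factor `h_{n_i}` carries `exp (K (n_i - 1))`, and
`∑ (n_i - 1) ≤ n - 2`, such a `K` absorbs all small divisors; the inequality
`N_m N_{n_1} ⋯ N_{n_m} ≤ N_n` does the same for the weights, and the rest is a majorant argument
with the sequence `1 / n ^ 2`. The outcome is `|h_n| ≤ c R ^ n exp (K (n - 1)) N_n` whenever `F` is
in the class of `N` (`norm_coeff_linearization_le`).

The function `K` has to satisfy `K n ≤ n (∑_{k ≤ k(n)} log q_{k+1} / q_k + γ)`, with constant `1` in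
front of the sum. Call `n` resonant of level `k` if `n ω` is within `1 / (4 q_k)` of an integer.
Differences of such `n` are multiples of `q_k` or at least `q_{k+1} / 2`. For each level we take the
largest total weight of a family of resonances of sum at most `n`, the weight being chosen so that a
resonance `n` outweighs, by one unit, every family of smaller sum
(`sum_resonanceWeight_add_one_le`). This maximum is superadditive by construction, jumps by one at
each resonance, and is at most `n / q_k + 4 n / q_{k+1}`; `K` is the sum over the levels with the
coefficients `log q_{k+1}` (`davie_add_le`, `exp_davie_le`, `davie_le`). The second term only
contributes to `γ`, because `∑ log q_k / q_k` converges for every irrational `ω`.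

The three assertions are one and the same estimate (`linearization_mem_of_bounded`), with `N = M`,
with `N = 1`, and with `N` arbitrary.
-/

namespace SiegelCenter

/-! ### Continued fractions and small divisors -/

theorem exists_int_contsAux (ω : ℝ) (k : ℕ) :
    ∃ a b : ℤ, (GenContFract.of ω).contsAux k = ⟨(a : ℝ), (b : ℝ)⟩ := by
  induction k using Nat.strong_induction_on with
  | _ k ih =>
    match k with
    | 0 => exact ⟨1, 0, by simp [GenContFract.contsAux]⟩
    | 1 => exact ⟨⌊ω⌋, 1, by simp [GenContFract.contsAux, GenContFract.of_h_eq_floor]⟩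
    | k + 2 =>
      rcases h : (GenContFract.of ω).s.get? k with _ | gp
      · obtain ⟨a, b, hab⟩ := ih (k + 1) (by omega)
        exact ⟨a, b, by rw [← hab]; simp [GenContFract.contsAux, h]⟩
      · obtain ⟨a, b, hab⟩ := ih (k + 1) (by omega)
        obtain ⟨a', b', hab'⟩ := ih k (by omega)
        obtain ⟨h1, z, hz⟩ := GenContFract.of_partNum_eq_one_and_exists_int_partDen_eq h
        refine ⟨z * a + a', z * b + b', ?_⟩
        rw [GenContFract.contsAux_recurrence h hab' hab, h1, hz]
        push_cast
        simp

theorem q_pos (ω : ℝ) (k : ℕ) : 0 < q ω k :=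
  lt_of_lt_of_le (by rw [q_zero]; exact one_pos) (q_mono ω (Nat.zero_le k))

theorem one_le_q (ω : ℝ) (k : ℕ) : 1 ≤ q ω k := by
  simpa [q_zero] using q_mono ω (Nat.zero_le k)

theorem log_q_nonneg (ω : ℝ) (k : ℕ) : 0 ≤ Real.log (q ω k) := Real.log_nonneg (one_le_q ω k)

/-- The convergents are reduced fractions which approximate `ω` with error at most
`1 / (q_k q_{k+1})`. -/
theorem exists_convergent {ω : ℝ} (hω : Irrational ω) (k : ℕ) :
    ∃ (a : ℤ) (b : ℕ), (b : ℝ) = q ω k ∧ IsCoprime (b : ℤ) a ∧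
      |ω - a / b| ≤ 1 / (b * q ω (k + 1)) := by
  obtain ⟨a, b, hab⟩ := exists_int_contsAux ω (k + 1)
  obtain ⟨a', b', hab'⟩ := exists_int_contsAux ω (k + 2)
  have hn : (GenContFract.of ω).nums k = a := by
    rw [GenContFract.num_eq_conts_a, GenContFract.nth_cont_eq_succ_nth_contAux, hab]
  have hd : (GenContFract.of ω).dens k = b := by
    rw [GenContFract.den_eq_conts_b, GenContFract.nth_cont_eq_succ_nth_contAux, hab]
  have hn' : (GenContFract.of ω).nums (k + 1) = a' := by
    rw [GenContFract.num_eq_conts_a, GenContFract.nth_cont_eq_succ_nth_contAux, hab']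
  have hd' : (GenContFract.of ω).dens (k + 1) = b' := by
    rw [GenContFract.den_eq_conts_b, GenContFract.nth_cont_eq_succ_nth_contAux, hab']
  have hdet := (SimpContFract.of ω).determinant (n := k) (not_terminatedAt hω k)
  change (GenContFract.of ω).nums k * (GenContFract.of ω).dens (k + 1) -
    (GenContFract.of ω).dens k * (GenContFract.of ω).nums (k + 1) = _ at hdet
  rw [hn, hd, hn', hd'] at hdet
  have hdet' : a * b' - b * a' = (-1) ^ (k + 1) := by exact_mod_cast hdet
  have hb : 0 < b := by
    have := q_pos ω k
    unfold q at this
    rw [hd] at this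
    exact_mod_cast this
  have hbb : ((b.toNat : ℤ) : ℤ) = b := Int.toNat_of_nonneg hb.le
  have hbr : ((b.toNat : ℕ) : ℝ) = b := by exact_mod_cast hbb
  refine ⟨a, b.toNat, ?_, ?_, ?_⟩
  · rw [hbr, q, hd]
  · rw [hbb]
    refine ⟨(-1) ^ (k + 1) * (-a'), (-1) ^ (k + 1) * b', ?_⟩
    have h1 : ((-1 : ℤ) ^ (k + 1)) * (-1) ^ (k + 1) = 1 := by
      rw [← mul_pow]; simp
    linear_combination (-1) ^ (k + 1) * hdet' + h1
  · have := GenContFract.abs_sub_convs_le (not_terminatedAt hω k)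
    rw [GenContFract.conv_eq_num_div_den, hn, hd] at this
    rw [hbr]
    exact this

/-- The set `A_k` of resonant times: integers `n ≥ 1` at which `n ω` is within `1 / (4 q_k)` of
an integer. -/
def resonant (ω : ℝ) (k : ℕ) : Set ℕ :=
  {n | 1 ≤ n ∧ ∃ p : ℤ, |n * ω - p| ≤ 1 / (4 * q ω k)}

/-- If `m ω` is close to an integer at scale `1 / q_k` and `q_k ∤ m`, then `m` is comparable
with `q_{k+1}`: modulo one, `m ω` differs from a nonzero multiple of `1 / q_k` by at most
`m / (q_k q_{k+1})`. -/
theorem dvd_or_le_of_abs_sub_le {ω : ℝ} {k a : ℤ} {b m : ℕ} {b' : ℝ} (hb : 0 < b) (hb' : 0 < b')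
    (hcop : IsCoprime (b : ℤ) a) (happ : |ω - a / b| ≤ 1 / (b * b'))
    (hm : |m * ω - k| ≤ 1 / (2 * b)) : b ∣ m ∨ b' / 2 ≤ m := by
  by_cases hd : b ∣ m
  · exact Or.inl hd
  right
  have hbr : (0 : ℝ) < b := by exact_mod_cast hb
  have hne : (m : ℤ) * a - k * b ≠ 0 := by
    intro h
    apply hd
    have h1 : (b : ℤ) ∣ m * a := ⟨k, by linarith⟩
    exact_mod_cast hcop.dvd_of_dvd_mul_right h1
  have h1 : (1 : ℝ) ≤ |(m : ℝ) * a - k * b| := by exact_mod_cast Int.one_le_abs hne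
  have h2 : (m : ℝ) * a - k * b = b * (m * ω - k) - b * m * (ω - a / b) := by
    field_simp
    ring
  have h3 : |(m : ℝ) * a - k * b| ≤ b * (1 / (2 * b)) + b * m * (1 / (b * b')) := by
    rw [h2]
    refine (abs_sub _ _).trans ?_
    rw [abs_mul, abs_mul (b * m : ℝ), abs_of_pos hbr, abs_of_nonneg (by positivity : (0:ℝ) ≤ b * m)]
    gcongr
  have h4 : (b : ℝ) * (1 / (2 * b)) + b * m * (1 / (b * b')) = 1 / 2 + m / b' := by
    field_simp
  rw [h4] at h3
  have h5 : 1 / 2 ≤ m / b' := by linarith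
  rw [le_div_iff₀ hb'] at h5
  linarith

theorem resonant_gap {ω : ℝ} (hω : Irrational ω) (k : ℕ) :
    ∃ b : ℕ, (b : ℝ) = q ω k ∧ ∀ v ∈ resonant ω k, ∀ w ∈ insert 0 (resonant ω k), w < v →
      b ∣ v - w ∨ q ω (k + 1) / 2 ≤ ((v - w : ℕ) : ℝ) := by
  obtain ⟨a, b, hb, hcop, happ⟩ := exists_convergent hω k
  refine ⟨b, hb, ?_⟩
  have hb0 : 0 < b := by
    have := q_pos ω k
    rw [← hb] at this
    exact_mod_cast this
  have hbr : (0 : ℝ) < b := by exact_mod_cast hb0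
  rintro v ⟨-, p, hp⟩ w hw hwv
  obtain ⟨r, hr⟩ : ∃ r : ℤ, |w * ω - r| ≤ 1 / (4 * q ω k) := by
    rcases hw with rfl | ⟨-, hw⟩
    · exact ⟨0, by have := q_pos ω k; simp; positivity⟩
    · exact hw
  refine dvd_or_le_of_abs_sub_le (k := p - r) hb0 (q_pos ω _) hcop happ ?_
  rw [← hb] at hp hr
  have h1 : ((v - w : ℕ) : ℝ) * ω - ((p - r : ℤ) : ℝ) = (v * ω - p) - (w * ω - r) := by
    push_cast [Nat.cast_sub hwv.le]
    ring
  rw [h1]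
  refine (abs_sub _ _).trans ((add_le_add hp hr).trans (le_of_eq ?_))
  field_simp
  norm_num

theorem le_of_mem_resonant {ω : ℝ} (hω : Irrational ω) {k n : ℕ} (hn : n ∈ resonant ω k) :
    q ω k ≤ n ∨ q ω (k + 1) / 2 ≤ n := by
  obtain ⟨b, hb, h⟩ := resonant_gap hω k
  have hn1 : 1 ≤ n := hn.1
  rcases h n hn 0 (Set.mem_insert _ _) hn1 with h | h
  · left
    rw [← hb]
    exact_mod_cast Nat.le_of_dvd hn1 h
  · right
    simpa using h

theorem lt_of_mem_resonant {ω : ℝ} (hω : Irrational ω) {k n : ℕ} (hn : n ∈ resonant ω k) :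
    k < 2 * n + 1 := by
  have h1 : q ω k ≤ 2 * n := by
    have := q_mono ω (Nat.le_succ k)
    simp only [Nat.succ_eq_add_one] at this
    have hn0 : (0 : ℝ) ≤ n := n.cast_nonneg
    rcases le_of_mem_resonant hω hn with h | h <;> linarith
  have h2 : (Nat.fib (k + 1) : ℝ) ≤ 2 * n := (fib_le_q hω k).trans h1
  have h3 : Nat.fib (k + 1) ≤ 2 * n := by exact_mod_cast h2
  have := Nat.le_fib_add_one (k + 1)
  omega

theorem norm_exp_pow_sub_one_ge (ω : ℝ) (n : ℕ) :
    4 * |n * ω - round (n * ω)| ≤ ‖Complex.exp (2 * Real.pi * Complex.I * ω) ^ n - 1‖ := by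
  set x : ℝ := n * ω - round (n * ω) with hx
  have h1 : Complex.exp (2 * Real.pi * Complex.I * ω) ^ n
      = Complex.exp (Complex.I * ((2 * Real.pi * x : ℝ) : ℂ)) := by
    rw [← Complex.exp_nat_mul, Complex.exp_eq_exp_iff_exists_int]
    refine ⟨round (n * ω), ?_⟩
    rw [hx]
    push_cast
    ring
  have hpi := Real.pi_pos
  have h2 : |Real.pi * x| ≤ Real.pi / 2 := by
    rw [abs_mul, abs_of_pos hpi]
    have := abs_sub_round (n * ω)
    rw [← hx] at this
    nlinarith
  have h3 := Real.mul_abs_le_abs_sin h2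
  rw [h1, Complex.norm_exp_I_mul_ofReal_sub_one, show 2 * Real.pi * x / 2 = Real.pi * x by ring,
    Real.norm_eq_abs, abs_mul, abs_two]
  rw [abs_mul, abs_of_pos hpi] at h3
  have h4 : 2 / Real.pi * (Real.pi * |x|) = 2 * |x| := by field_simp
  rw [h4] at h3
  linarith

theorem exp_pow_ne_one {ω : ℝ} (hω : Irrational ω) {n : ℕ} (hn : 1 ≤ n) :
    Complex.exp (2 * Real.pi * Complex.I * ω) ^ n ≠ 1 := by
  intro h
  have h1 := norm_exp_pow_sub_one_ge ω n
  rw [h, sub_self, norm_zero] at h1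
  have h2 : (n : ℝ) * ω - round (n * ω) = 0 := by
    have := abs_nonneg ((n : ℝ) * ω - round (n * ω))
    exact abs_eq_zero.1 (by linarith)
  have h3 : Irrational ((n : ℝ) * ω) := hω.natCast_mul (by omega)
  exact h3.ne_int (round (n * ω)) (by linarith)

/-- Outside `A_k` the divisor `λ ^ n - 1` has size at least `1 / q_k`. -/
theorem one_le_of_notMem_resonant {ω : ℝ} {k n : ℕ} (hn : 1 ≤ n) (h : n ∉ resonant ω k) :
    1 ≤ q ω k * ‖Complex.exp (2 * Real.pi * Complex.I * ω) ^ n - 1‖ := by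
  have h1 : 1 / (4 * q ω k) < |n * ω - round (n * ω)| := by
    by_contra! h2
    exact h ⟨hn, _, h2⟩
  have hq := q_pos ω k
  have h2 := norm_exp_pow_sub_one_ge ω n
  rw [div_lt_iff₀ (by positivity)] at h1
  nlinarith

theorem pow_le_q {ω : ℝ} (hω : Irrational ω) (k : ℕ) : (3 / 2 : ℝ) ^ k / 2 ≤ q ω k := by
  have h : ∀ k : ℕ, (3 / 2 : ℝ) ^ k ≤ 2 * Nat.fib (k + 1) ∧
      (3 / 2 : ℝ) ^ (k + 1) ≤ 2 * Nat.fib (k + 2) := by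
    intro k
    induction k with
    | zero => norm_num
    | succ k ih =>
      refine ⟨ih.2, ?_⟩
      rw [show k + 1 + 2 = k + 1 + 2 from rfl, Nat.fib_add_two (n := k + 1)]
      push_cast
      have h1 := ih.1
      have h2 := ih.2
      have : (0:ℝ) < (3 / 2 : ℝ) ^ k := by positivity
      rw [pow_succ] at h2 ⊢
      rw [pow_succ]
      nlinarith
  have := (h k).1
  have := fib_le_q hω k
  linarith

/-- The denominators grow exponentially, so `∑ log q_k / q_k` converges for every irrational. -/
theorem summable_log_q_div {ω : ℝ} (hω : Irrational ω) :
    Summable fun k : ℕ => Real.log (q ω k) / q ω k := by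
  have h0 : ∀ x : ℝ, 0 < x → Real.log x / x ≤ 2 * (Real.sqrt x)⁻¹ := by
    intro x hx
    have hs : 0 < Real.sqrt x := Real.sqrt_pos.2 hx
    have h1 : Real.log x = 2 * Real.log (Real.sqrt x) := by rw [Real.log_sqrt hx.le]; ring
    have h2 := Real.log_le_sub_one_of_pos hs
    rw [div_le_iff₀ hx, h1]
    have h3 : (Real.sqrt x)⁻¹ * x = Real.sqrt x := by
      nth_rewrite 2 [← Real.mul_self_sqrt hx.le]
      field_simp
    rw [mul_assoc, h3]
    linarith
  have hg : Summable fun k : ℕ => 2 * Real.sqrt 2 * (Real.sqrt (2 / 3)) ^ k := by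
    refine Summable.mul_left _ (summable_geometric_of_lt_one (Real.sqrt_nonneg _) ?_)
    rw [Real.sqrt_lt' one_pos]
    norm_num
  refine Summable.of_nonneg_of_le
    (fun k => div_nonneg (log_q_nonneg ω k) (q_pos ω k).le) (fun k => ?_) hg
  refine (h0 _ (q_pos ω k)).trans ?_
  rw [mul_assoc]
  gcongr
  have h1 : Real.sqrt ((3 / 2 : ℝ) ^ k / 2) ≤ Real.sqrt (q ω k) := Real.sqrt_le_sqrt (pow_le_q hω k)
  have h2 : 0 < Real.sqrt ((3 / 2 : ℝ) ^ k / 2) := Real.sqrt_pos.2 (by positivity)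
  refine (inv_anti₀ h2 h1).trans (le_of_eq ?_)
  rw [← Real.sqrt_inv, inv_div, Real.sqrt_eq_iff_mul_self_eq (by positivity) (by positivity)]
  rw [mul_mul_mul_comm, Real.mul_self_sqrt (by norm_num), ← mul_pow,
    Real.mul_self_sqrt (by norm_num), div_pow, div_pow]
  field_simp

/-! ### Counting resonances -/

/-- The weight of a resonance `v`, for a set whose differences are multiples of `b` or at
least `E`. A resonance below `E` is a multiple of `b` and weighs `v / b`; a long one, `v ≥ E`,
weighs `2 v / E - 1` more. The `- 1` makes up for the resonance itself when two or more long ones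
sit below it, and `2 v / E ≥ 2` keeps the weight large enough when there is none. -/
noncomputable def resonanceWeight (b : ℕ) (E : ℝ) (v : ℕ) : ℝ :=
  v / b + if E ≤ v then 2 * v / E - 1 else 0

/-- The total weights of families of elements of `A` (with repetitions) of sum at most `n`. -/
def familyWeights (A : Set ℕ) (b : ℕ) (E : ℝ) (n : ℕ) : Set ℝ :=
  {x | ∃ s : Multiset ℕ, (∀ v ∈ s, v ∈ A) ∧ s.sum ≤ n ∧ (s.map (resonanceWeight b E)).sum = x}

/-- The maximal weight of a family of elements of `A` of sum at most `n`. -/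
noncomputable def maxWeight (A : Set ℕ) (b : ℕ) (E : ℝ) (n : ℕ) : ℝ := sSup (familyWeights A b E n)

section Counting

variable {A : Set ℕ} {b : ℕ} {E : ℝ}

theorem resonanceWeight_le (hE : 0 < E) (v : ℕ) :
    resonanceWeight b E v ≤ (1 / b + 2 / E) * v := by
  unfold resonanceWeight
  have h1 : (v : ℝ) / b = 1 / b * v := by ring
  have h2 : 2 * (v : ℝ) / E = 2 / E * v := by ring
  have h3 : 0 ≤ 2 / E * (v : ℝ) := by positivity
  split_ifs <;> rw [h1] <;> linarith

theorem sum_resonanceWeight_le (hE : 0 < E) (s : Multiset ℕ) :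
    (s.map (resonanceWeight b E)).sum ≤ (1 / b + 2 / E) * s.sum := by
  induction s using Multiset.induction_on with
  | empty => simp
  | cons v s ih =>
    simp only [Multiset.map_cons, Multiset.sum_cons, Nat.cast_add, mul_add]
    exact add_le_add (resonanceWeight_le hE v) ih

theorem sum_resonanceWeight_of_long (s : Multiset ℕ) (hs : ∀ v ∈ s, E ≤ v) :
    (s.map (resonanceWeight b E)).sum = s.sum / b + 2 * s.sum / E - Multiset.card s := by
  induction s using Multiset.induction_on with
  | empty => simp
  | cons v s ih =>
    simp only [Multiset.map_cons, Multiset.sum_cons, Nat.cast_add, Multiset.card_cons]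
    rw [ih fun w hw => hs w (Multiset.mem_cons_of_mem hw), resonanceWeight,
      if_pos (hs v (Multiset.mem_cons_self v s))]
    push_cast
    ring

theorem sum_resonanceWeight_of_short (s : Multiset ℕ) (hs : ∀ v ∈ s, ¬ E ≤ v) :
    (s.map (resonanceWeight b E)).sum = s.sum / b := by
  induction s using Multiset.induction_on with
  | empty => simp
  | cons v s ih =>
    simp only [Multiset.map_cons, Multiset.sum_cons, Nat.cast_add]
    rw [ih fun w hw => hs w (Multiset.mem_cons_of_mem hw), resonanceWeight,
      if_neg (hs v (Multiset.mem_cons_self v s))]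
    ring

theorem familyWeights_nonempty (A : Set ℕ) (b : ℕ) (E : ℝ) (n : ℕ) :
    (familyWeights A b E n).Nonempty := ⟨0, 0, by simp, by simp, by simp⟩

theorem le_of_mem_familyWeights (hE : 0 < E) {n : ℕ} {x : ℝ} (hx : x ∈ familyWeights A b E n) :
    x ≤ (1 / b + 2 / E) * n := by
  obtain ⟨s, -, h2, rfl⟩ := hx
  refine (sum_resonanceWeight_le hE s).trans ?_
  have : (s.sum : ℝ) ≤ n := by exact_mod_cast h2
  gcongr

theorem bddAbove_familyWeights (hE : 0 < E) (n : ℕ) : BddAbove (familyWeights A b E n) :=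
  ⟨_, fun _ hx => le_of_mem_familyWeights hE hx⟩

theorem maxWeight_le (hE : 0 < E) (n : ℕ) : maxWeight A b E n ≤ (1 / b + 2 / E) * n :=
  csSup_le (familyWeights_nonempty A b E n) fun _ hx => le_of_mem_familyWeights hE hx

theorem maxWeight_nonneg (hE : 0 < E) (n : ℕ) : 0 ≤ maxWeight A b E n :=
  le_csSup (bddAbove_familyWeights hE n) ⟨0, by simp, by simp, by simp⟩

theorem maxWeight_mono (hE : 0 < E) : Monotone (maxWeight A b E) := fun m n hmn =>
  csSup_le_csSup (bddAbove_familyWeights hE n) (familyWeights_nonempty A b E m)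
    fun _ ⟨s, h1, h2, h3⟩ => ⟨s, h1, h2.trans hmn, h3⟩

theorem maxWeight_add_le (hE : 0 < E) (m n : ℕ) :
    maxWeight A b E m + maxWeight A b E n ≤ maxWeight A b E (m + n) := by
  rw [← le_sub_iff_add_le]
  refine csSup_le (familyWeights_nonempty A b E m) fun x ⟨s, h1, h2, h3⟩ => ?_
  rw [le_sub_comm]
  refine csSup_le (familyWeights_nonempty A b E n) fun y ⟨t, g1, g2, g3⟩ => ?_
  rw [le_sub_iff_add_le, add_comm]
  refine le_csSup (bddAbove_familyWeights hE _) ⟨s + t, ?_, ?_, ?_⟩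
  · intro v hv
    rcases Multiset.mem_add.1 hv with hv | hv
    exacts [h1 v hv, g1 v hv]
  · rw [Multiset.sum_add]
    omega
  · rw [Multiset.map_add, Multiset.sum_add, h3, g3]

theorem maxWeight_eq_zero {n : ℕ} (h : ∀ v ∈ A, n < v) : maxWeight A b E n = 0 := by
  have : familyWeights A b E n = {0} := by
    refine Set.eq_singleton_iff_unique_mem.2 ⟨⟨0, by simp, by simp, by simp⟩, ?_⟩
    rintro x ⟨s, h1, h2, rfl⟩
    rcases s.empty_or_exists_mem with rfl | ⟨v, hv⟩
    · simp
    · have := h v (h1 v hv)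
      have := Multiset.le_sum_of_mem hv
      omega
  rw [maxWeight, this, csSup_singleton]

/-- A resonance weighs at least one more than any family of resonances of smaller sum.
Only the number of long members of the family matters: two of them save `2` on their own; a
single one, `w`, either lies `E` below `n`, or then the whole sum is a multiple of `b` away from
`n`; and if there is none, the long resonance `n` carries `2 n / E - 1 ≥ 1`. -/
theorem sum_resonanceWeight_add_one_le (hb : 0 < b) (hE : 0 < E)
    (hA : ∀ v ∈ A, ∀ w ∈ insert 0 A, w < v → b ∣ v - w ∨ E ≤ ((v - w : ℕ) : ℝ))
    {n : ℕ} (hn : n ∈ A) {s : Multiset ℕ} (hs : ∀ v ∈ s, v ∈ A) (hsn : s.sum < n) :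
    (s.map (resonanceWeight b E)).sum + 1 ≤ resonanceWeight b E n := by
  classical
  have hbr : (0 : ℝ) < b := by exact_mod_cast hb
  have hshort : ∀ v ∈ A, ¬ E ≤ v → b ∣ v := by
    intro v hv hvE
    rcases Nat.eq_zero_or_pos v with rfl | h0
    · exact dvd_zero b
    · rcases hA v hv 0 (Set.mem_insert _ _) h0 with h | h
      · simpa using h
      · exact absurd (by simpa using h) hvE
  have hgap : ∀ k l : ℕ, l < k → b ∣ k - l → (l : ℝ) / b + 1 ≤ k / b := by
    intro k l hlk hd
    have h1 : b ≤ k - l := Nat.le_of_dvd (by omega) hd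
    have h2 : (l : ℝ) + b ≤ k := by exact_mod_cast (by omega : l + b ≤ k)
    rw [div_add_one hbr.ne']
    gcongr
  obtain ⟨t, u, rfl, ht, hu⟩ : ∃ t u : Multiset ℕ, s = t + u ∧ (∀ v ∈ t, E ≤ v) ∧
      ∀ v ∈ u, ¬ E ≤ v :=
    ⟨s.filter fun v => E ≤ (v : ℝ), s.filter fun v => ¬ E ≤ (v : ℝ),
      (Multiset.filter_add_not _ s).symm, fun v hv => (Multiset.mem_filter.1 hv).2,
      fun v hv => (Multiset.mem_filter.1 hv).2⟩
  have hud : b ∣ u.sum := Multiset.dvd_sum fun v hv =>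
    hshort v (hs v (Multiset.mem_add.2 (Or.inr hv))) (hu v hv)
  rw [Multiset.map_add, Multiset.sum_add, sum_resonanceWeight_of_long t ht,
    sum_resonanceWeight_of_short u hu]
  rw [Multiset.sum_add] at hsn
  have hlt : (t.sum : ℝ) + u.sum ≤ n := by exact_mod_cast hsn.le
  have hltb : (t.sum : ℝ) / b + u.sum / b ≤ n / b := by
    rw [← add_div]
    gcongr
  have htE : 2 * (t.sum : ℝ) / E ≤ 2 * n / E := by
    have : (t.sum : ℝ) ≤ n := le_trans (le_add_of_nonneg_right (Nat.cast_nonneg _)) hlt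
    gcongr
  rcases t.empty_or_exists_mem with rfl | ⟨w, hw⟩
  · simp only [Multiset.sum_zero, Multiset.card_zero] at hltb hsn ⊢
    by_cases hnE : E ≤ n
    · have : 2 ≤ 2 * (n : ℝ) / E := by
        rw [le_div_iff₀ hE]
        linarith
      rw [resonanceWeight, if_pos hnE]
      simp only [Nat.cast_zero, zero_div, mul_zero] at hltb ⊢
      linarith
    · have := hgap n u.sum (by omega) (Nat.dvd_sub (hshort n hn hnE) hud)
      rw [resonanceWeight, if_neg hnE]
      simp only [Nat.cast_zero, zero_div, mul_zero]
      linarith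
  · have hwt : w ≤ t.sum := Multiset.le_sum_of_mem hw
    have hwn : w < n := by omega
    have hnE : E ≤ n := (ht w hw).trans (by exact_mod_cast hwn.le)
    rw [resonanceWeight, if_pos hnE]
    obtain ⟨r, rfl⟩ := Multiset.exists_cons_of_mem hw
    rcases r.empty_or_exists_mem with rfl | ⟨w', hw'⟩
    · simp only [Multiset.sum_cons, Multiset.sum_zero, add_zero, Multiset.card_cons,
        Multiset.card_zero, zero_add, Nat.cast_one] at hsn hltb htE ⊢
      rcases hA n hn w (Set.mem_insert_of_mem _ (hs w (Multiset.mem_add.2 (Or.inl hw)))) hwn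
        with h | h
      · have h1 := hgap n (w + u.sum) hsn (by rw [Nat.sub_add_eq]; exact Nat.dvd_sub h hud)
        rw [Nat.cast_add, add_div] at h1
        linarith
      · rw [Nat.cast_sub hwn.le] at h
        have h1 : 1 ≤ ((n : ℝ) - w) / E := by rwa [le_div_iff₀ hE, one_mul]
        have h2 : 2 * (n : ℝ) / E = 2 * w / E + 2 * ((n - w) / E) := by ring
        linarith
    · have hc : (2 : ℝ) ≤ Multiset.card (w ::ₘ r) := by
        have : 0 < Multiset.card r := Multiset.card_pos_iff_exists_mem.2 ⟨w', hw'⟩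
        rw [Multiset.card_cons]
        exact_mod_cast (by omega : 2 ≤ Multiset.card r + 1)
      linarith

theorem maxWeight_add_one_le (hb : 0 < b) (hE : 0 < E)
    (hA : ∀ v ∈ A, ∀ w ∈ insert 0 A, w < v → b ∣ v - w ∨ E ≤ ((v - w : ℕ) : ℝ))
    {n : ℕ} (hn : n + 1 ∈ A) : maxWeight A b E n + 1 ≤ maxWeight A b E (n + 1) := by
  rw [← le_sub_iff_add_le]
  refine csSup_le (familyWeights_nonempty A b E n) fun x ⟨s, h1, h2, h3⟩ => ?_
  rw [le_sub_iff_add_le, ← h3]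
  refine (sum_resonanceWeight_add_one_le hb hE hA hn h1 (by omega)).trans ?_
  exact le_csSup (bddAbove_familyWeights hE _) ⟨{n + 1}, by simpa using hn, by simp, by simp⟩

end Counting

/-- The maximal weight of a family of resonances of level `k` of sum at most `n`. -/
noncomputable def resonanceCount (ω : ℝ) (k n : ℕ) : ℝ :=
  maxWeight (resonant ω k) ⌊q ω k⌋₊ (q ω (k + 1) / 2) n

section Level

variable {ω : ℝ}

theorem half_q_pos (ω : ℝ) (k : ℕ) : 0 < q ω k / 2 := half_pos (q_pos ω k)

theorem floor_q (hω : Irrational ω) (k : ℕ) : ((⌊q ω k⌋₊ : ℕ) : ℝ) = q ω k := by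
  obtain ⟨b, hb, -⟩ := resonant_gap hω k
  rw [← hb, Nat.floor_natCast]

theorem resonanceCount_nonneg (ω : ℝ) (k n : ℕ) : 0 ≤ resonanceCount ω k n :=
  maxWeight_nonneg (half_q_pos ω _) n

theorem resonanceCount_mono (ω : ℝ) (k : ℕ) : Monotone (resonanceCount ω k) :=
  maxWeight_mono (half_q_pos ω _)

theorem resonanceCount_add_le (ω : ℝ) (k m n : ℕ) :
    resonanceCount ω k m + resonanceCount ω k n ≤ resonanceCount ω k (m + n) :=
  maxWeight_add_le (half_q_pos ω _) m n

theorem resonanceCount_add_one_le (hω : Irrational ω) {k n : ℕ} (hn : n + 1 ∈ resonant ω k) :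
    resonanceCount ω k n + 1 ≤ resonanceCount ω k (n + 1) := by
  obtain ⟨b, hb, h⟩ := resonant_gap hω k
  have hb0 : 0 < b := by
    have := q_pos ω k
    rw [← hb] at this
    exact_mod_cast this
  rw [resonanceCount, resonanceCount, ← hb, Nat.floor_natCast]
  exact maxWeight_add_one_le hb0 (half_q_pos ω _) h hn

theorem resonanceCount_le (hω : Irrational ω) (k n : ℕ) :
    resonanceCount ω k n ≤ n / q ω k + 4 * n / q ω (k + 1) := by
  refine (maxWeight_le (half_q_pos ω _) n).trans (le_of_eq ?_)
  rw [floor_q hω]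
  have := q_pos ω k
  have := q_pos ω (k + 1)
  field_simp
  ring

/-- Levels `k > k(n)` contribute only if `q_{k+1} ≤ 2 n < 2 q_k`, and then little. -/
theorem resonanceCount_le_of_lt (hω : Irrational ω) {k n : ℕ} (hn : (n : ℝ) < q ω k) :
    resonanceCount ω k n ≤ 6 * n / q ω (k + 1) := by
  have h1 := q_pos ω k
  have h2 := q_pos ω (k + 1)
  have hn0 : (0 : ℝ) ≤ n := n.cast_nonneg
  by_cases hE : q ω (k + 1) / 2 ≤ n
  · refine (resonanceCount_le hω k n).trans ?_
    have h3 : (n : ℝ) / q ω k ≤ 2 * n / q ω (k + 1) := by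
      rw [div_le_div_iff₀ h1 h2]
      nlinarith
    have h4 : 6 * (n : ℝ) / q ω (k + 1) = 2 * n / q ω (k + 1) + 4 * n / q ω (k + 1) := by ring
    linarith
  · have : resonanceCount ω k n = 0 := maxWeight_eq_zero fun v hv => by
      push Not at hE
      rcases le_of_mem_resonant hω hv with h | h
      · exact_mod_cast hn.trans_le h
      · exact_mod_cast hE.trans_le h
    rw [this]
    positivity

end Level

/-- A variant of Davie's function `K`: it is superadditive, and its increments dominate the
logarithms of the inverse small divisors. Resonances of level `k ≥ 2 n + 1` are larger than `n`, so
that the truncation of the sum is harmless. -/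
noncomputable def davie (ω : ℝ) (n : ℕ) : ℝ :=
  ∑ k ∈ Finset.range (2 * n + 1), resonanceCount ω k n * Real.log (q ω (k + 1))

section Davie

variable {ω : ℝ}

theorem davie_term_nonneg (ω : ℝ) (k n : ℕ) :
    0 ≤ resonanceCount ω k n * Real.log (q ω (k + 1)) :=
  mul_nonneg (resonanceCount_nonneg ω k n) (log_q_nonneg ω _)

theorem davie_nonneg (ω : ℝ) (n : ℕ) : 0 ≤ davie ω n :=
  Finset.sum_nonneg fun k _ => davie_term_nonneg ω k n

theorem davie_le_sum (ω : ℝ) {n l : ℕ} (h : 2 * n + 1 ≤ l) :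
    davie ω n ≤ ∑ k ∈ Finset.range l, resonanceCount ω k n * Real.log (q ω (k + 1)) :=
  Finset.sum_le_sum_of_subset_of_nonneg (Finset.range_mono h)
    fun k _ _ => davie_term_nonneg ω k n

theorem davie_add_le (ω : ℝ) (m n : ℕ) : davie ω m + davie ω n ≤ davie ω (m + n) := by
  refine (add_le_add (davie_le_sum ω (l := 2 * (m + n) + 1) (by omega))
    (davie_le_sum ω (l := 2 * (m + n) + 1) (by omega))).trans ?_
  rw [← Finset.sum_add_distrib]
  refine Finset.sum_le_sum fun k _ => ?_
  rw [← add_mul]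
  exact mul_le_mul_of_nonneg_right (resonanceCount_add_le ω k m n) (log_q_nonneg ω _)

theorem davie_mono (ω : ℝ) : Monotone (davie ω) := by
  intro m n hmn
  obtain ⟨k, rfl⟩ := Nat.exists_eq_add_of_le hmn
  linarith [davie_add_le ω m k, davie_nonneg ω k]

/-- The small divisor `λ ^ (n + 1) - 1` is paid for by the last level `k` at which `n + 1` is
resonant. -/
theorem exp_davie_le (hω : Irrational ω) (n : ℕ) :
    Real.exp (davie ω n) ≤
      ‖Complex.exp (2 * Real.pi * Complex.I * ω) ^ (n + 1) - 1‖ * Real.exp (davie ω (n + 1)) := by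
  set d := ‖Complex.exp (2 * Real.pi * Complex.I * ω) ^ (n + 1) - 1‖ with hd
  by_cases h0 : n + 1 ∈ resonant ω 0
  · obtain ⟨k, hk, hk'⟩ : ∃ k, n + 1 ∈ resonant ω k ∧ n + 1 ∉ resonant ω (k + 1) := by
      by_contra! h
      have hall : ∀ k, n + 1 ∈ resonant ω k := fun k => by
        induction k with
        | zero => exact h0
        | succ k ih => exact h k ih
      have := lt_of_mem_resonant hω (hall (2 * (n + 1) + 1))
      omega
    have hqd := one_le_of_notMem_resonant (by omega : 1 ≤ n + 1) hk'
    rw [← hd] at hqd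
    have hkl := lt_of_mem_resonant hω hk
    have key : davie ω n + Real.log (q ω (k + 1)) ≤ davie ω (n + 1) := by
      have h1 := davie_le_sum ω (n := n) (l := 2 * (n + 1) + 1) (by omega)
      have h2 : ∑ i ∈ Finset.range (2 * (n + 1) + 1), (resonanceCount ω i n *
          Real.log (q ω (i + 1)) + if i = k then Real.log (q ω (k + 1)) else 0)
          ≤ davie ω (n + 1) := by
        refine Finset.sum_le_sum fun i _ => ?_
        have hlog := log_q_nonneg ω (i + 1)
        split_ifs with hik
        · subst hik
          have := mul_le_mul_of_nonneg_right (resonanceCount_add_one_le hω hk) hlog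
          linarith
        · rw [add_zero]
          exact mul_le_mul_of_nonneg_right (resonanceCount_mono ω i n.le_succ) hlog
      rw [Finset.sum_add_distrib, Finset.sum_ite_eq' _ _ _,
        if_pos (Finset.mem_range.2 hkl)] at h2
      linarith
    have hq := q_pos ω (k + 1)
    calc Real.exp (davie ω n) ≤ (q ω (k + 1) * d) * Real.exp (davie ω n) :=
          le_mul_of_one_le_left (Real.exp_pos _).le hqd
      _ = d * Real.exp (davie ω n + Real.log (q ω (k + 1))) := by
          rw [Real.exp_add, Real.exp_log hq]; ring
      _ ≤ _ := by
          have := norm_nonneg (Complex.exp (2 * Real.pi * Complex.I * ω) ^ (n + 1) - 1)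
          gcongr
  · have hqd := one_le_of_notMem_resonant (by omega : 1 ≤ n + 1) h0
    rw [q_zero, one_mul, ← hd] at hqd
    calc Real.exp (davie ω n) ≤ Real.exp (davie ω (n + 1)) :=
          Real.exp_le_exp.2 (davie_mono ω n.le_succ)
      _ ≤ _ := le_mul_of_one_le_left (Real.exp_pos _).le hqd

/-- The growth of `K` is governed by the partial Brjuno sum with constant `1`: the level `k`
contributes `n log q_{k+1} / q_k`, and the corrections `n log q_{k+1} / q_{k+1}` are summable for
every irrational `ω`. -/
theorem davie_le (hω : Irrational ω) :
    ∃ γ : ℝ, ∀ n : ℕ, 1 ≤ n → davie ω n ≤ n * (brjunoSum ω n + γ) := by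
  have hsum : Summable fun k : ℕ => Real.log (q ω (k + 1)) / q ω (k + 1) :=
    (summable_nat_add_iff (f := fun k : ℕ => Real.log (q ω k) / q ω k) 1).2 (summable_log_q_div hω)
  have hnn : ∀ k, 0 ≤ Real.log (q ω (k + 1)) / q ω (k + 1) := fun k =>
    div_nonneg (log_q_nonneg ω _) (q_pos ω _).le
  refine ⟨6 * ∑' k : ℕ, Real.log (q ω (k + 1)) / q ω (k + 1), fun n hn => ?_⟩
  have hspec := kIndex_spec hω hn
  have hbn : brjunoSum ω n = ∑ k ∈ Finset.range (kIndex ω n + 1),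
    Real.log (q ω (k + 1)) / q ω k := rfl
  set κ := kIndex ω n
  set l := max (2 * n + 1) (κ + 1) with hl
  have hn0 : (0 : ℝ) ≤ n := n.cast_nonneg
  have hterm : ∀ k, resonanceCount ω k n * Real.log (q ω (k + 1)) ≤
      n * ((if k ∈ Finset.range (κ + 1) then Real.log (q ω (k + 1)) / q ω k else 0) +
        6 * (Real.log (q ω (k + 1)) / q ω (k + 1))) := by
    intro k
    have hlog := log_q_nonneg ω (k + 1)
    have hnk := hnn k
    split_ifs with hk
    · have := mul_le_mul_of_nonneg_right (resonanceCount_le hω k n) hlog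
      have h2 : ((n : ℝ) / q ω k + 4 * n / q ω (k + 1)) * Real.log (q ω (k + 1)) =
        n * (Real.log (q ω (k + 1)) / q ω k + 4 * (Real.log (q ω (k + 1)) / q ω (k + 1))) := by
        ring
      rw [h2] at this
      refine this.trans ?_
      gcongr
      norm_num
    · have hk' : (n : ℝ) < q ω k :=
        hspec.2.trans_le (q_mono ω (by simpa using hk))
      have := mul_le_mul_of_nonneg_right (resonanceCount_le_of_lt hω hk') hlog
      refine this.trans (le_of_eq ?_)
      ring
  calc davie ω n ≤ ∑ k ∈ Finset.range l, resonanceCount ω k n * Real.log (q ω (k + 1)) :=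
        davie_le_sum ω (le_max_left _ _)
    _ ≤ ∑ k ∈ Finset.range l, n * ((if k ∈ Finset.range (κ + 1) then
          Real.log (q ω (k + 1)) / q ω k else 0) + 6 * (Real.log (q ω (k + 1)) / q ω (k + 1))) :=
        Finset.sum_le_sum fun k _ => hterm k
    _ = n * (brjunoSum ω n + 6 * ∑ k ∈ Finset.range l, Real.log (q ω (k + 1)) / q ω (k + 1)) := by
        rw [← Finset.mul_sum, Finset.sum_add_distrib, ← Finset.mul_sum, Finset.sum_ite_mem,
          Finset.inter_eq_right.2 (Finset.range_mono (le_max_right _ _)), ← hbn]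
    _ ≤ _ := by
        gcongr
        exact hsum.sum_le_tsum _ fun k _ => hnn k

end Davie

/-! ### The formal linearization -/

section Formal

theorem coeff_pow_eq_zero {H : ℂ⟦X⟧} (hH : PowerSeries.constantCoeff H = 0) {n m : ℕ}
    (h : n < m) : PowerSeries.coeff n (H ^ m) = 0 :=
  PowerSeries.X_pow_dvd_iff.1 (pow_dvd_pow_of_dvd (PowerSeries.X_dvd_iff.2 hH) m) n h

/-- For `m ≥ 2` the coefficient of index `n` of `H ^ m` involves only the coefficients of `H`
of index less than `n`. -/
theorem coeff_pow_congr {G H : ℂ⟦X⟧} (hG : PowerSeries.constantCoeff G = 0)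
    (hH : PowerSeries.constantCoeff H = 0) {n m : ℕ} (hm : 2 ≤ m)
    (h : ∀ k < n, PowerSeries.coeff k G = PowerSeries.coeff k H) :
    PowerSeries.coeff n (G ^ m) = PowerSeries.coeff n (H ^ m) := by
  have h1 : (PowerSeries.X : ℂ⟦X⟧) ^ n ∣ G - H := PowerSeries.X_pow_dvd_iff.2 fun k hk => by
    rw [map_sub, h k hk, sub_self]
  have hGX := PowerSeries.X_dvd_iff.2 hG
  have hHX := PowerSeries.X_dvd_iff.2 hH
  have h2 : (PowerSeries.X : ℂ⟦X⟧) ∣ ∑ i ∈ Finset.range m, G ^ i * H ^ (m - 1 - i) :=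
    Finset.dvd_sum fun i _ => by
      rcases Nat.eq_zero_or_pos i with rfl | hi
      · exact Dvd.dvd.mul_left (dvd_pow hHX (by omega)) _
      · exact Dvd.dvd.mul_right (dvd_pow hGX (by omega)) _
  have h3 : (PowerSeries.X : ℂ⟦X⟧) ^ (n + 1) ∣ G ^ m - H ^ m := by
    rw [← (Commute.all G H).geom_sum₂_mul, pow_succ']
    exact mul_dvd_mul h2 h1
  have h4 := PowerSeries.X_pow_dvd_iff.1 h3 n n.lt_succ_self
  rwa [map_sub, sub_eq_zero] at h4

theorem coeff_subst_eq_sum {F H : ℂ⟦X⟧} (hH : PowerSeries.constantCoeff H = 0) (n : ℕ) :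
    PowerSeries.coeff n (PowerSeries.subst H F) =
      ∑ m ∈ Finset.range (n + 1), PowerSeries.coeff m F * PowerSeries.coeff n (H ^ m) := by
  rw [PowerSeries.coeff_subst' (PowerSeries.HasSubst.of_constantCoeff_zero' hH)]
  rw [finsum_eq_sum_of_support_subset (s := Finset.range (n + 1))]
  · simp [smul_eq_mul]
  · intro m hm
    by_contra h
    simp only [Finset.coe_range, Set.mem_Iio, not_lt] at h
    exact hm (by simp [coeff_pow_eq_zero hH (show n < m by omega)])

theorem coeff_subst_C_mul_X (lam : ℂ) (H : ℂ⟦X⟧) (n : ℕ) :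
    PowerSeries.coeff n (PowerSeries.subst (PowerSeries.C lam * PowerSeries.X : ℂ⟦X⟧) H) =
      lam ^ n * PowerSeries.coeff n H := by
  rw [← PowerSeries.smul_eq_C_mul, ← PowerSeries.rescale_eq_subst, PowerSeries.coeff_rescale]

theorem isLinearization_iff {F : ℂ⟦X⟧} {lam : ℂ} (hF₀ : PowerSeries.constantCoeff F = 0)
    (hF₁ : PowerSeries.coeff 1 F = lam) (H : ℂ⟦X⟧) :
    IsLinearization F lam H ↔ PowerSeries.constantCoeff H = 0 ∧ PowerSeries.coeff 1 H = 1 ∧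
      ∀ n, 2 ≤ n → (lam ^ n - lam) * PowerSeries.coeff n H =
        ∑ m ∈ Finset.Icc 2 n, PowerSeries.coeff m F * PowerSeries.coeff n (H ^ m) := by
  have hF0 : PowerSeries.coeff 0 F = 0 := by simpa using hF₀
  have hsplit : ∀ n, 2 ≤ n → ∑ m ∈ Finset.range (n + 1), PowerSeries.coeff m F *
      PowerSeries.coeff n (H ^ m) = lam * PowerSeries.coeff n H +
        ∑ m ∈ Finset.Icc 2 n, PowerSeries.coeff m F * PowerSeries.coeff n (H ^ m) := by
    intro n hn
    rw [Finset.range_eq_Ico, Finset.sum_eq_sum_Ico_succ_bot (by omega),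
      Finset.sum_eq_sum_Ico_succ_bot (by omega), hF0, hF₁, zero_mul, zero_add, zero_add, pow_one]
    rfl
  constructor
  · rintro ⟨h0, h1, h⟩
    refine ⟨h0, h1, fun n hn => ?_⟩
    have h2 := congrArg (PowerSeries.coeff n) h
    rw [coeff_subst_eq_sum h0, coeff_subst_C_mul_X, hsplit n hn] at h2
    linear_combination -h2
  · rintro ⟨h0, h1, h⟩
    refine ⟨h0, h1, ?_⟩
    ext n
    rw [coeff_subst_eq_sum h0, coeff_subst_C_mul_X]
    match n with
    | 0 =>
      have : PowerSeries.coeff 0 H = 0 := by simpa using h0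
      simp [hF₀, h0]
    | 1 => simp [Finset.sum_range_succ, hF₀, hF₁, h1]
    | n + 2 =>
      rw [hsplit _ (by omega)]
      linear_combination -h (n + 2) (by omega)

/-- The coefficients of the linearization, by recursion on the homological equation. -/
noncomputable def linCoeff (F : ℂ⟦X⟧) (lam : ℂ) : ℕ → ℂ
  | 0 => 0
  | 1 => 1
  | n + 2 => (∑ m ∈ Finset.Icc 2 (n + 2), PowerSeries.coeff m F * PowerSeries.coeff (n + 2)
      ((PowerSeries.mk fun k => if _h : k < n + 2 then linCoeff F lam k else 0) ^ m)) /
        (lam ^ (n + 2) - lam)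

theorem exists_isLinearization {F : ℂ⟦X⟧} {lam : ℂ} (hlam : ∀ n, 2 ≤ n → lam ^ n ≠ lam)
    (hF₀ : PowerSeries.constantCoeff F = 0) (hF₁ : PowerSeries.coeff 1 F = lam) :
    ∃ H, IsLinearization F lam H := by
  have h0 : PowerSeries.constantCoeff (PowerSeries.mk (linCoeff F lam)) = 0 := by
    rw [← PowerSeries.coeff_zero_eq_constantCoeff_apply, PowerSeries.coeff_mk, linCoeff]
  refine ⟨PowerSeries.mk (linCoeff F lam), (isLinearization_iff hF₀ hF₁ _).2 ⟨h0, ?_, ?_⟩⟩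
  · rw [PowerSeries.coeff_mk, linCoeff]
  · intro n hn
    obtain ⟨n, rfl⟩ := Nat.exists_eq_add_of_le' hn
    have hne : lam ^ (n + 2) - lam ≠ 0 := sub_ne_zero.2 (hlam _ hn)
    rw [PowerSeries.coeff_mk, linCoeff, mul_div_cancel₀ _ hne]
    refine Finset.sum_congr rfl fun m hm => ?_
    congr 1
    refine coeff_pow_congr ?_ h0 (Finset.mem_Icc.1 hm).1 fun k hk => ?_
    · rw [← PowerSeries.coeff_zero_eq_constantCoeff_apply, PowerSeries.coeff_mk,
        dif_pos (by omega), linCoeff]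
    · rw [PowerSeries.coeff_mk, PowerSeries.coeff_mk, dif_pos hk]

theorem IsLinearization.unique {F : ℂ⟦X⟧} {lam : ℂ} (hlam : ∀ n, 2 ≤ n → lam ^ n ≠ lam)
    (hF₀ : PowerSeries.constantCoeff F = 0) (hF₁ : PowerSeries.coeff 1 F = lam) {G H : ℂ⟦X⟧}
    (hG : IsLinearization F lam G) (hH : IsLinearization F lam H) : G = H := by
  obtain ⟨g0, g1, hg⟩ := (isLinearization_iff hF₀ hF₁ G).1 hG
  obtain ⟨h0, h1, hh⟩ := (isLinearization_iff hF₀ hF₁ H).1 hH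
  ext n
  induction n using Nat.strong_induction_on with
  | _ n ih =>
    match n with
    | 0 => simp [g0, h0]
    | 1 => rw [g1, h1]
    | n + 2 =>
      have hne : lam ^ (n + 2) - lam ≠ 0 := sub_ne_zero.2 (hlam _ (by omega))
      refine mul_left_cancel₀ hne ?_
      rw [hg _ (by omega), hh _ (by omega)]
      refine Finset.sum_congr rfl fun m hm => ?_
      rw [coeff_pow_congr g0 h0 (Finset.mem_Icc.1 hm).1 ih]

end Formal

/-! ### Majorants -/

section Majorant

/-- The sequence `1 / n²` is, up to the factor `8`, stable under convolution; the value at `0`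
is the junk value `1 / 0 = 0`. -/
theorem sum_antidiagonal_inv_sq_le (n : ℕ) :
    ∑ p ∈ Finset.HasAntidiagonal.antidiagonal n, 1 / (p.1 : ℝ) ^ 2 * (1 / (p.2 : ℝ) ^ 2) ≤
      8 * (1 / (n : ℝ) ^ 2) := by
  have hsum : ∑ k ∈ Finset.range (n + 1), 1 / (k : ℝ) ^ 2 ≤ (2 : ℝ) := by
    have h : ∀ n : ℕ, ∑ k ∈ Finset.range (n + 1), 1 / (k : ℝ) ^ 2 ≤ (2 : ℝ) - 1 / (n : ℝ) := by
      intro n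
      induction n with
      | zero => norm_num
      | succ n ih =>
        rw [Finset.sum_range_succ]
        rcases Nat.eq_zero_or_pos n with rfl | hn
        · norm_num
        have hn' : (0 : ℝ) < n := by exact_mod_cast hn
        have h1 : 1 / ((n + 1 : ℕ) : ℝ) ^ 2 ≤ 1 / n - 1 / (n + 1 : ℕ) := by
          push_cast
          rw [div_sub_div _ _ hn'.ne' (by positivity), div_le_div_iff₀ (by positivity)
            (by positivity)]
          nlinarith
        linarith
    refine (h n).trans ?_
    have : (0 : ℝ) ≤ 1 / n := by positivity
    linarith
  have hterm : ∀ p ∈ Finset.HasAntidiagonal.antidiagonal n,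
      1 / (p.1 : ℝ) ^ 2 * (1 / (p.2 : ℝ) ^ 2) ≤
      2 * (1 / (n : ℝ) ^ 2) * (1 / (p.1 : ℝ) ^ 2) +
        2 * (1 / (n : ℝ) ^ 2) * (1 / (p.2 : ℝ) ^ 2) := by
    rintro ⟨a, b⟩ hp
    obtain rfl := (Finset.HasAntidiagonal.mem_antidiagonal.1 hp).symm
    dsimp only
    rcases Nat.eq_zero_or_pos a with rfl | ha
    · simp only [Nat.cast_zero, ne_eq, OfNat.ofNat_ne_zero, not_false_eq_true, zero_pow, div_zero,
        zero_mul, mul_zero, zero_add]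
      positivity
    rcases Nat.eq_zero_or_pos b with rfl | hb
    · simp only [Nat.cast_zero, ne_eq, OfNat.ofNat_ne_zero, not_false_eq_true, zero_pow, div_zero,
        mul_zero, add_zero]
      positivity
    have ha' : (0 : ℝ) < a := by exact_mod_cast ha
    have hb' : (0 : ℝ) < b := by exact_mod_cast hb
    push_cast
    have h1 : 2 * (1 / ((a : ℝ) + b) ^ 2) * (1 / (a : ℝ) ^ 2) +
        2 * (1 / ((a : ℝ) + b) ^ 2) * (1 / (b : ℝ) ^ 2) =
        (2 * (a ^ 2 + b ^ 2)) / ((a + b) ^ 2 * (a ^ 2 * b ^ 2)) := by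
      field_simp
      ring
    rw [h1, one_div_mul_one_div, div_le_div_iff₀ (by positivity) (by positivity), one_mul]
    refine mul_le_mul_of_nonneg_right ?_ (by positivity)
    nlinarith [sq_nonneg ((a : ℝ) - b)]
  refine (Finset.sum_le_sum hterm).trans ?_
  rw [Finset.sum_add_distrib, ← Finset.mul_sum, ← Finset.mul_sum,
    Finset.Nat.sum_antidiagonal_eq_sum_range_succ_mk,
    Finset.Nat.sum_antidiagonal_eq_sum_range_succ_mk]
  have hrefl : ∑ k ∈ Finset.range (n + 1), 1 / ((n - k : ℕ) : ℝ) ^ 2 =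
      ∑ k ∈ Finset.range (n + 1), 1 / (k : ℝ) ^ 2 := by
    rw [← Finset.sum_range_reflect]
    refine Finset.sum_congr rfl fun k hk => ?_
    have := Finset.mem_range.1 hk
    congr 3
    omega
  simp only [Nat.succ_eq_add_one]
  rw [hrefl]
  have : (0 : ℝ) ≤ 1 / (n : ℝ) ^ 2 := by positivity
  nlinarith

/-- Convolution estimate for the powers of `H`. The factor `N m` is the one which comes with the
coefficient of `F`; it is carried along because `N_m N_b ≤ N_{m+b-1}` loses one unit of index at
each multiplication, exactly as many as the number of factors of `H ^ j`. -/
theorem norm_coeff_pow_le {N K : ℕ → ℝ} (hN : ∀ n, 1 ≤ n → 0 < N n)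
    (hcomp : ∀ m n, 1 ≤ m → 1 ≤ n → N n * N m ≤ N (m + n - 1))
    (hK : ∀ m n, K m + K n ≤ K (m + n)) {H : ℂ⟦X⟧} (hH : PowerSeries.constantCoeff H = 0)
    {ε R : ℝ} (hε : 0 < ε) (hR : 0 < R) {L : ℕ}
    (hL : ∀ k, 1 ≤ k → k ≤ L → ‖PowerSeries.coeff k H‖ ≤
      ε * R ^ k * (1 / (k : ℝ) ^ 2) * Real.exp (K (k - 1)) * N k) (j : ℕ) :
    ∀ n m, j + 1 ≤ n → n ≤ L + j → 1 ≤ m → N m * ‖PowerSeries.coeff n (H ^ (j + 1))‖ ≤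
      ε * (8 * ε) ^ j * R ^ n * (1 / (n : ℝ) ^ 2) * Real.exp (K (n - (j + 1))) *
        N (m + n - (j + 1)) := by
  induction j with
  | zero =>
    intro n m hn hnL hm
    rw [zero_add, pow_one, pow_zero, mul_one]
    calc N m * ‖PowerSeries.coeff n H‖
        ≤ N m * (ε * R ^ n * (1 / (n : ℝ) ^ 2) * Real.exp (K (n - 1)) * N n) :=
          mul_le_mul_of_nonneg_left (hL n (by omega) (by omega)) (hN m hm).le
      _ = ε * R ^ n * (1 / (n : ℝ) ^ 2) * Real.exp (K (n - 1)) * (N n * N m) := by ring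
      _ ≤ _ := mul_le_mul_of_nonneg_left (hcomp m n hm (by omega)) (by positivity)
  | succ j ih =>
    intro n m hn hnL hm
    set c := ε * (8 * ε) ^ j * ε * R ^ n * Real.exp (K (n - (j + 2))) *
      N (m + n - (j + 2)) with hc
    have hNn : 0 < N (m + n - (j + 2)) := hN _ (by omega)
    have hc0 : 0 ≤ c := by positivity
    have hterm : ∀ p ∈ Finset.HasAntidiagonal.antidiagonal n,
        N m * ‖PowerSeries.coeff p.1 (H ^ (j + 1)) * PowerSeries.coeff p.2 H‖ ≤
          c * (1 / (p.1 : ℝ) ^ 2 * (1 / (p.2 : ℝ) ^ 2)) := by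
      rintro ⟨a, b⟩ hp
      have hab : a + b = n := Finset.HasAntidiagonal.mem_antidiagonal.1 hp
      dsimp only
      rcases lt_or_ge a (j + 1) with ha | ha
      · rw [coeff_pow_eq_zero hH ha, zero_mul, norm_zero, mul_zero]
        positivity
      rcases Nat.eq_zero_or_pos b with rfl | hb
      · rw [PowerSeries.coeff_zero_eq_constantCoeff_apply, hH, mul_zero, norm_zero, mul_zero]
        positivity
      have h1 := hL b hb (by omega)
      have h2 := ih a (m + b - 1) ha (by omega) (by omega)
      rw [show m + b - 1 + a - (j + 1) = m + n - (j + 2) by omega] at h2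
      have h3 : Real.exp (K (a - (j + 1))) * Real.exp (K (b - 1)) ≤
          Real.exp (K (n - (j + 2))) := by
        rw [← Real.exp_add, Real.exp_le_exp]
        refine (hK _ _).trans (le_of_eq ?_)
        congr 1
        omega
      rw [norm_mul]
      calc N m * (‖PowerSeries.coeff a (H ^ (j + 1))‖ * ‖PowerSeries.coeff b H‖)
          ≤ N m * (‖PowerSeries.coeff a (H ^ (j + 1))‖ *
              (ε * R ^ b * (1 / (b : ℝ) ^ 2) * Real.exp (K (b - 1)) * N b)) := by
            have := (hN m hm).le
            gcongr
        _ = ε * R ^ b * (1 / (b : ℝ) ^ 2) * Real.exp (K (b - 1)) *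
              ((N b * N m) * ‖PowerSeries.coeff a (H ^ (j + 1))‖) := by ring
        _ ≤ ε * R ^ b * (1 / (b : ℝ) ^ 2) * Real.exp (K (b - 1)) *
              (N (m + b - 1) * ‖PowerSeries.coeff a (H ^ (j + 1))‖) := by
            gcongr
            exact hcomp m b hm hb
        _ ≤ ε * R ^ b * (1 / (b : ℝ) ^ 2) * Real.exp (K (b - 1)) *
              (ε * (8 * ε) ^ j * R ^ a * (1 / (a : ℝ) ^ 2) * Real.exp (K (a - (j + 1))) *
                N (m + n - (j + 2))) := by gcongr
        _ = ε * (8 * ε) ^ j * ε * (R ^ a * R ^ b) *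
              (Real.exp (K (a - (j + 1))) * Real.exp (K (b - 1))) * N (m + n - (j + 2)) *
              (1 / (a : ℝ) ^ 2 * (1 / (b : ℝ) ^ 2)) := by ring
        _ ≤ ε * (8 * ε) ^ j * ε * (R ^ a * R ^ b) * Real.exp (K (n - (j + 2))) *
              N (m + n - (j + 2)) * (1 / (a : ℝ) ^ 2 * (1 / (b : ℝ) ^ 2)) := by gcongr
        _ = _ := by rw [hc, ← pow_add, hab]
    rw [pow_succ H, PowerSeries.coeff_mul]
    calc N m * ‖∑ p ∈ Finset.HasAntidiagonal.antidiagonal n,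
            PowerSeries.coeff p.1 (H ^ (j + 1)) * PowerSeries.coeff p.2 H‖
        ≤ ∑ p ∈ Finset.HasAntidiagonal.antidiagonal n,
            N m * ‖PowerSeries.coeff p.1 (H ^ (j + 1)) * PowerSeries.coeff p.2 H‖ := by
          rw [← Finset.mul_sum]
          exact mul_le_mul_of_nonneg_left (norm_sum_le _ _) (hN m hm).le
      _ ≤ c * ∑ p ∈ Finset.HasAntidiagonal.antidiagonal n,
            1 / (p.1 : ℝ) ^ 2 * (1 / (p.2 : ℝ) ^ 2) := by
          rw [Finset.mul_sum]
          exact Finset.sum_le_sum hterm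
      _ ≤ c * (8 * (1 / (n : ℝ) ^ 2)) :=
          mul_le_mul_of_nonneg_left (sum_antidiagonal_inv_sq_le n) hc0
      _ = _ := by rw [hc]; ring

/-- Siegel–Davie majorant method: the small divisors are absorbed by the superadditive function
`K`, and what remains is an estimate for an analytic implicit function problem. -/
theorem norm_coeff_linearization_le {F H : ℂ⟦X⟧} {lam : ℂ} (hlam : ‖lam‖ = 1)
    (hF₀ : PowerSeries.constantCoeff F = 0) (hF₁ : PowerSeries.coeff 1 F = lam)
    (hH : IsLinearization F lam H) {N K : ℕ → ℝ} (hN : ∀ n, 1 ≤ n → 0 < N n)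
    (hcomp : ∀ m n, 1 ≤ m → 1 ≤ n → N n * N m ≤ N (m + n - 1))
    (hF : F ∈ ultradifferentiableClass N)
    (hK0 : 0 ≤ K 0) (hK : ∀ m n, K m + K n ≤ K (m + n)) (hKm : Monotone K)
    (hdiv : ∀ n, Real.exp (K n) ≤ ‖lam ^ (n + 1) - 1‖ * Real.exp (K (n + 1))) :
    ∃ c R : ℝ, 0 < c ∧ 0 < R ∧ ∀ n, 1 ≤ n →
      ‖PowerSeries.coeff n H‖ ≤ c * R ^ n * Real.exp (K (n - 1)) * N n := by
  obtain ⟨-, c₁, c₂, hc₁, hc₂, hFn⟩ := hF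
  obtain ⟨h0, h1, hh⟩ := (isLinearization_iff hF₀ hF₁ H).1 hH
  -- `ε` is chosen so that the geometric series `∑_{j ≥ 1} c₁ c₂ (8 ε c₂)^j` is at most `1`.
  obtain ⟨ε, hε, hx1, hx2⟩ : ∃ ε : ℝ, 0 < ε ∧ 8 * ε * c₂ ≤ 1 / 2 ∧
      c₁ * c₂ * (2 * (8 * ε * c₂)) ≤ 1 := by
    refine ⟨1 / (16 * c₂ * (1 + c₁ * c₂)), by positivity, ?_, ?_⟩
    · have : 8 * (1 / (16 * c₂ * (1 + c₁ * c₂))) * c₂ = 1 / (2 * (1 + c₁ * c₂)) := by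
        field_simp
        norm_num
      rw [this]
      have : 0 < c₁ * c₂ := by positivity
      exact one_div_le_one_div_of_le (by norm_num) (by linarith)
    · have : c₁ * c₂ * (2 * (8 * (1 / (16 * c₂ * (1 + c₁ * c₂))) * c₂)) =
          (c₁ * c₂) / (1 + c₁ * c₂) := by
        field_simp
        norm_num
      rw [this, div_le_one (by positivity)]
      linarith
  set x := 8 * ε * c₂ with hx
  have hx0 : 0 < x := by positivity
  have hgeom : ∀ n : ℕ, ∑ j ∈ Finset.range n, x ^ (j + 1) ≤ 2 * x := by
    intro n
    have : ∑ j ∈ Finset.range n, x ^ j ≤ 2 := by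
      have h := Summable.sum_le_tsum (Finset.range n) (fun j _ => pow_nonneg hx0.le j)
        (summable_geometric_of_lt_one hx0.le (by linarith))
      rw [tsum_geometric_of_lt_one hx0.le (by linarith)] at h
      refine h.trans ?_
      rw [inv_le_comm₀ (by linarith) (by norm_num)]
      linarith
    simp only [pow_succ]
    rw [← Finset.sum_mul]
    nlinarith
  have hN1 := hN 1 le_rfl
  set R := 1 / (ε * N 1) with hR
  have hR0 : 0 < R := by positivity
  have key : ∀ n, 1 ≤ n → ‖PowerSeries.coeff n H‖ ≤
      ε * R ^ n * (1 / (n : ℝ) ^ 2) * Real.exp (K (n - 1)) * N n := by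
    intro n
    induction n using Nat.strong_induction_on with
    | _ n ih =>
      intro hn
      match n, hn with
      | 1, _ =>
        have : ε * R * N 1 = 1 := by
          rw [hR]
          field_simp
        have h2 : ε * R ^ 1 * (1 / ((1 : ℕ) : ℝ) ^ 2) * Real.exp (K (1 - 1)) * N 1 =
            ε * R * N 1 * Real.exp (K 0) := by
          norm_num
          ring
        rw [h1, norm_one, h2, this, one_mul]
        exact Real.one_le_exp hK0
      | n + 2, _ =>
        have hNn := hN (n + 2) (by omega)
        set D := ‖lam ^ (n + 1) - 1‖ with hD
        have hdn := hdiv n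
        rw [← hD] at hdn
        have hDpos : 0 < D := by
          by_contra! hD0
          have := mul_nonpos_of_nonpos_of_nonneg hD0 (Real.exp_pos (K (n + 1))).le
          have := Real.exp_pos (K n)
          linarith
        have hterm : ∀ m ∈ Finset.Icc 2 (n + 2),
            ‖PowerSeries.coeff m F * PowerSeries.coeff (n + 2) (H ^ m)‖ ≤
            ε * R ^ (n + 2) * (1 / ((n + 2 : ℕ) : ℝ) ^ 2) * Real.exp (K n) * N (n + 2) *
              (c₁ * c₂ * x ^ (m - 1)) := by
          intro m hm
          obtain ⟨hm2, hmn⟩ := Finset.mem_Icc.1 hm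
          obtain ⟨j, rfl⟩ := Nat.exists_eq_add_of_le' (show 1 ≤ m by omega)
          have hp := norm_coeff_pow_le hN hcomp hK h0 hε hR0 (L := n + 1)
            (fun k hk hkn => ih k (by omega) hk) j (n + 2) (j + 1) hmn (by omega) (by omega)
          rw [show j + 1 + (n + 2) - (j + 1) = n + 2 by omega] at hp
          have hKK : Real.exp (K (n + 2 - (j + 1))) ≤ Real.exp (K n) :=
            Real.exp_le_exp.2 (hKm (by omega))
          rw [norm_mul]
          calc ‖PowerSeries.coeff (j + 1) F‖ * ‖PowerSeries.coeff (n + 2) (H ^ (j + 1))‖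
              ≤ c₁ * c₂ ^ (j + 1) * N (j + 1) * ‖PowerSeries.coeff (n + 2) (H ^ (j + 1))‖ :=
                mul_le_mul_of_nonneg_right (hFn _ (by omega)) (norm_nonneg _)
            _ = c₁ * c₂ ^ (j + 1) *
                  (N (j + 1) * ‖PowerSeries.coeff (n + 2) (H ^ (j + 1))‖) := by ring
            _ ≤ c₁ * c₂ ^ (j + 1) * (ε * (8 * ε) ^ j * R ^ (n + 2) *
                  (1 / ((n + 2 : ℕ) : ℝ) ^ 2) * Real.exp (K (n + 2 - (j + 1))) * N (n + 2)) := by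
                gcongr
            _ ≤ c₁ * c₂ ^ (j + 1) * (ε * (8 * ε) ^ j * R ^ (n + 2) *
                  (1 / ((n + 2 : ℕ) : ℝ) ^ 2) * Real.exp (K n) * N (n + 2)) := by gcongr
            _ = _ := by
                rw [Nat.add_sub_cancel, hx, mul_pow (8 * ε) c₂ j, pow_succ c₂ j]
                ring
        have hsumx : ∑ m ∈ Finset.Icc 2 (n + 2), x ^ (m - 1) ≤ 2 * x := by
          refine le_trans (le_of_eq ?_) (hgeom (n + 1))
          rw [Finset.range_eq_Ico, ← Finset.Ico_add_one_right_eq_Icc,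
            show n + 2 + 1 = (n + 1) + 2 from rfl]
          nth_rewrite 1 [show 2 = 0 + 2 from rfl]
          rw [← Finset.sum_Ico_add']
          rfl
        have hmain : D * ‖PowerSeries.coeff (n + 2) H‖ ≤
            ε * R ^ (n + 2) * (1 / ((n + 2 : ℕ) : ℝ) ^ 2) * Real.exp (K n) * N (n + 2) := by
          have h2 : D * ‖PowerSeries.coeff (n + 2) H‖ =
              ‖(lam ^ (n + 2) - lam) * PowerSeries.coeff (n + 2) H‖ := by
            rw [norm_mul, show lam ^ (n + 2) - lam = lam * (lam ^ (n + 1) - 1) by ring, norm_mul,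
              hlam, one_mul]
          rw [h2, hh _ (by omega)]
          refine (norm_sum_le _ _).trans ((Finset.sum_le_sum hterm).trans ?_)
          rw [← Finset.mul_sum, ← Finset.mul_sum]
          refine mul_le_of_le_one_right (by positivity) ?_
          refine le_trans ?_ hx2
          gcongr
        rw [show n + 2 - 1 = n + 1 by omega]
        refine le_of_mul_le_mul_left (hmain.trans ?_) hDpos
        calc ε * R ^ (n + 2) * (1 / ((n + 2 : ℕ) : ℝ) ^ 2) * Real.exp (K n) * N (n + 2)
            ≤ ε * R ^ (n + 2) * (1 / ((n + 2 : ℕ) : ℝ) ^ 2) * (D * Real.exp (K (n + 1))) *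
              N (n + 2) := by gcongr
          _ = _ := by ring
  refine ⟨ε, R, hε, hR0, fun n hn => (key n hn).trans ?_⟩
  have := (hN n hn).le
  have h2 : 1 / (n : ℝ) ^ 2 ≤ 1 := by
    rw [div_le_one (by positivity)]
    exact one_le_pow₀ (by exact_mod_cast hn)
  calc ε * R ^ n * (1 / (n : ℝ) ^ 2) * Real.exp (K (n - 1)) * N n
      ≤ ε * R ^ n * 1 * Real.exp (K (n - 1)) * N n := by gcongr
    _ = _ := by ring

end Majorant

/-! ### From estimates to weighted classes -/

theorem mem_ultradifferentiableClass_of_eventually {M : ℕ → ℝ} (hM : ∀ n, 1 ≤ n → 0 < M n)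
    {H : ℂ⟦X⟧} (hH : PowerSeries.constantCoeff H = 0) {c R : ℝ} (hc : 0 < c) (hR : 0 < R)
    (h : ∀ᶠ n in atTop, ‖PowerSeries.coeff n H‖ ≤ c * R ^ n * M n) :
    H ∈ ultradifferentiableClass M := by
  obtain ⟨n₀, hn₀⟩ := eventually_atTop.1 h
  set S := ∑ k ∈ Finset.range n₀, ‖PowerSeries.coeff k H‖ / |R ^ k * M k| with hS
  have hS0 : 0 ≤ S := Finset.sum_nonneg fun k _ => by positivity
  refine ⟨hH, c + S, R, by positivity, hR, fun n hn => ?_⟩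
  have hMn := hM n hn
  rcases le_or_gt n₀ n with h1 | h1
  · refine (hn₀ n h1).trans ?_
    gcongr
    linarith
  · have h2 : ‖PowerSeries.coeff n H‖ / |R ^ n * M n| ≤ S :=
      Finset.single_le_sum (f := fun k => ‖PowerSeries.coeff k H‖ / |R ^ k * M k|)
        (fun k _ => by positivity) (Finset.mem_range.2 h1)
    have h3 : 0 < R ^ n * M n := by positivity
    rw [abs_of_pos h3, div_le_iff₀ h3] at h2
    refine h2.trans ?_
    rw [mul_assoc]
    gcongr
    linarith

theorem analyticGerms_subset : analyticGerms ⊆ ultradifferentiableClass fun _ => 1 := by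
  rintro F ⟨hF₀, hF⟩
  obtain ⟨r, hr0, hr⟩ := ENNReal.lt_iff_exists_nnreal_btwn.1 hF
  have hr0' : 0 < r := by exact_mod_cast hr0
  obtain ⟨C, hC, h⟩ := FormalMultilinearSeries.norm_le_div_pow_of_pos_of_lt_radius _ hr0' hr
  have hrr : (0 : ℝ) < r := by exact_mod_cast hr0'
  refine ⟨hF₀, C, (r : ℝ)⁻¹, hC, inv_pos.2 hrr, fun n _ => ?_⟩
  have h1 := h n
  rw [FormalMultilinearSeries.ofScalars_norm] at h1
  rw [mul_one, inv_pow, ← div_eq_mul_inv]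
  exact h1

/-- If `F` has growth `N` and the partial Brjuno sums exceed `log (M_n / N_n) / n` by at most a
constant, then the linearization has growth `M`. -/
theorem linearization_mem_of_bounded {ω : ℝ} (hω : Irrational ω) {F H : ℂ⟦X⟧}
    (hF₀ : PowerSeries.constantCoeff F = 0)
    (hF₁ : PowerSeries.coeff 1 F = Complex.exp (2 * Real.pi * Complex.I * ω))
    (hH : IsLinearization F (Complex.exp (2 * Real.pi * Complex.I * ω)) H)
    {M N : ℕ → ℝ} (hM : ∀ n, 1 ≤ n → 0 < M n) (hN : ∀ n, 1 ≤ n → 0 < N n)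
    (hcomp : ∀ m n, 1 ≤ m → 1 ≤ n → N n * N m ≤ N (m + n - 1))
    (hF : F ∈ ultradifferentiableClass N) {C : ℝ}
    (hC : ∀ᶠ n : ℕ in atTop, brjunoSum ω n - 1 / (n : ℝ) * Real.log (M n / N n) ≤ C) :
    H ∈ ultradifferentiableClass M := by
  have hlam : ‖Complex.exp (2 * Real.pi * Complex.I * ω)‖ = 1 := by
    rw [show 2 * (Real.pi : ℂ) * Complex.I * ω = ((2 * Real.pi * ω : ℝ) : ℂ) * Complex.I by
      push_cast; ring]
    exact Complex.norm_exp_ofReal_mul_I _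
  obtain ⟨c, R, hc, hR, h⟩ := norm_coeff_linearization_le hlam hF₀ hF₁ hH hN hcomp hF
    (davie_nonneg ω 0) (davie_add_le ω) (davie_mono ω) (exp_davie_le hω)
  obtain ⟨γ, hγ⟩ := davie_le hω
  refine mem_ultradifferentiableClass_of_eventually hM hH.constantCoeff_eq hc
    (R := R * Real.exp (C + γ)) (by positivity) ?_
  filter_upwards [hC, eventually_ge_atTop 1] with n hCn hn
  have hn0 : (0 : ℝ) < n := by exact_mod_cast hn
  have hMn := hM n hn
  have hNn := hN n hn
  have h1 : davie ω (n - 1) ≤ n * (C + γ) + Real.log (M n / N n) := by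
    have h2 := (davie_mono ω (Nat.sub_le n 1)).trans (hγ n hn)
    have h3 : (n : ℝ) * (brjunoSum ω n - 1 / (n : ℝ) * Real.log (M n / N n)) ≤ n * C :=
      mul_le_mul_of_nonneg_left hCn hn0.le
    have h4 : (n : ℝ) * (brjunoSum ω n - 1 / (n : ℝ) * Real.log (M n / N n)) =
        n * brjunoSum ω n - Real.log (M n / N n) := by
      field_simp
    linarith
  have h5 : Real.exp (davie ω (n - 1)) ≤ Real.exp (C + γ) ^ n * (M n / N n) := by
    refine (Real.exp_le_exp.2 h1).trans (le_of_eq ?_)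
    rw [Real.exp_add, Real.exp_log (by positivity), Real.exp_nat_mul]
  calc ‖PowerSeries.coeff n H‖ ≤ c * R ^ n * Real.exp (davie ω (n - 1)) * N n := h n hn
    _ ≤ c * R ^ n * (Real.exp (C + γ) ^ n * (M n / N n)) * N n := by gcongr
    _ = c * (R * Real.exp (C + γ)) ^ n * M n := by
        rw [mul_pow]
        field_simp

theorem eventually_le_of_limsup_lt_top {u : ℕ → ℝ}
    (h : limsup (fun n => (u n : EReal)) atTop < ⊤) : ∃ C : ℝ, ∀ᶠ n in atTop, u n ≤ C := by
  obtain ⟨C, hC, -⟩ := EReal.lt_iff_exists_real_btwn.1 h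
  refine ⟨C, (eventually_lt_of_limsup_lt hC).mono fun n hn => ?_⟩
  exact (EReal.coe_lt_coe_iff.1 hn).le

theorem IsBrjuno.brjunoSum_le {ω : ℝ} (h : IsBrjuno ω) (n : ℕ) :
    brjunoSum ω n ≤ ∑' k : ℕ, Real.log (q ω (k + 1)) / q ω k :=
  h.2.sum_le_tsum _ fun _ _ => div_nonneg (log_q_nonneg ω _) (q_pos ω _).le

end SiegelCenter

theorem theorem2p2 (ω : ℝ) (hω : Irrational ω)
    (M : ℕ → ℝ) (hM : SiegelCenter.IsUltradifferentiableWeight M)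
    (F : ℂ⟦X⟧) (hF₀ : PowerSeries.constantCoeff F = 0)
    (hF₁ : PowerSeries.coeff 1 F = Complex.exp (2 * Real.pi * Complex.I * ω)) :
    ∃ H : ℂ⟦X⟧,
      -- `H` is the linearization of `F`
      (SiegelCenter.IsLinearization F (Complex.exp (2 * Real.pi * Complex.I * ω)) H ∧
        ∀ G : ℂ⟦X⟧,
          SiegelCenter.IsLinearization F (Complex.exp (2 * Real.pi * Complex.I * ω)) G → G = H) ∧
      -- 1.
      (F ∈ SiegelCenter.ultradifferentiableClass M → SiegelCenter.IsBrjuno ω →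
        H ∈ SiegelCenter.ultradifferentiableClass M) ∧
      -- 2.
      (F ∈ SiegelCenter.analyticGerms →
        limsup (fun n : ℕ =>
          ((SiegelCenter.brjunoSum ω n - 1 / (n : ℝ) * Real.log (M n) : ℝ) : EReal)) atTop < ⊤ →
        H ∈ SiegelCenter.ultradifferentiableClass M) ∧
      -- 3.
      (∀ N : ℕ → ℝ, SiegelCenter.IsUltradifferentiableWeight N →
        (∀ᶠ n : ℕ in atTop, N n ≤ M n) →
        F ∈ SiegelCenter.ultradifferentiableClass N →
        limsup (fun n : ℕ =>
          ((SiegelCenter.brjunoSum ω n - 1 / (n : ℝ) * Real.log (M n / N n) : ℝ) : EReal))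
            atTop < ⊤ →
        H ∈ SiegelCenter.ultradifferentiableClass M) := by
  have hlam : ∀ n, 2 ≤ n → Complex.exp (2 * Real.pi * Complex.I * ω) ^ n ≠
      Complex.exp (2 * Real.pi * Complex.I * ω) := by
    intro n hn h
    obtain ⟨n, rfl⟩ := Nat.exists_eq_add_of_le' hn
    refine SiegelCenter.exp_pow_ne_one hω (by omega : 1 ≤ n + 1) ?_
    refine mul_right_cancel₀ (Complex.exp_ne_zero (2 * Real.pi * Complex.I * ω)) ?_
    rw [one_mul, ← pow_succ]
    exact h
  obtain ⟨H, hH⟩ := SiegelCenter.exists_isLinearization hlam hF₀ hF₁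
  refine ⟨H, ⟨hH, fun G hG => hG.unique hlam hF₀ hF₁ hH⟩, fun hF hB => ?_, fun hF hlim => ?_,
    fun N hN _ hF hlim => ?_⟩
  · refine SiegelCenter.linearization_mem_of_bounded hω hF₀ hF₁ hH hM.pos hM.pos hM.composition hF
      (C := ∑' k : ℕ, Real.log (SiegelCenter.q ω (k + 1)) / SiegelCenter.q ω k) ?_
    filter_upwards [eventually_ge_atTop 1] with n hn
    rw [div_self (hM.pos n hn).ne', Real.log_one, mul_zero, sub_zero]
    exact hB.brjunoSum_le n
  · obtain ⟨C, hC⟩ := SiegelCenter.eventually_le_of_limsup_lt_top hlim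
    refine SiegelCenter.linearization_mem_of_bounded hω hF₀ hF₁ hH hM.pos (N := fun _ => 1)
      (fun _ _ => one_pos) (fun _ _ _ _ => by norm_num)
      (SiegelCenter.analyticGerms_subset hF) (C := C) ?_
    simpa using hC
  · obtain ⟨C, hC⟩ := SiegelCenter.eventually_le_of_limsup_lt_top hlim
    exact SiegelCenter.linearization_mem_of_bounded hω hF₀ hF₁ hH hM.pos hN.pos hN.composition hF hC
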